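/- **Theorem 3.1.** Let $N\ge 2$, let $\Omega\subset\mathbb{R}^N$ be a bounded domain (nonempty, open and connected), let $b\in C(\partial\Omega)$, and let $f:\Omega\times\mathbb{R}\to\mathbb{R}$ be continuous with $$\sup_{\Omega\times I}|f(x,t)|<\infty\qquad\text{for every compact interval } I\subset\mathbb{R}.$$ For a $C^2$ function $\psi$ put $\Delta_\infty\psi:=\langle D^2\psi\,D\psi,D\psi\rangle$. A function $u\in C(\Omega)$ is a (viscosity) sub-solution of $\Delta_\infty u=f(x,u)$ in $\Omega$ if, for every $\psi\in C^2(\Omega)$ and every $x_0\in\Omega$ at which $u-\psi$ has a local maximum, $\Delta_\infty\psi(x_0)\ge f(x_0,u(x_0))$; it is a (viscosity) super-solution if, for every $\psi\in C^2(\Omega)$ and every $x_0\in\Omega$ at which $u-\psi$ has a local minimum, $\Delta_\infty\psi(x_0)\le f(x_0,u(x_0))$; it is a viscosity solution if it is both. Consider the Dirichlet problem $$\Delta_\infty u=f(x,u)\ \text{ in }\Omega,\qquad u=b\ \text{ on }\partial\Omega. \tag{DP}$$ A sub-solution of (DP) is a function $w\in C(\overline\Omega)$ that is a sub-solution of the equation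 in $\Omega$ and satisfies $w\le b$ on $\partial\Omega$; a super-solution of (DP) is a function $v\in C(\overline\Omega)$ that is a super-solution of the equation in $\Omega$ and satisfies $v\ge b$ on $\partial\Omega$; a solution of (DP) is a function $u\in C(\overline\Omega)$ that is a viscosity solution of the equation in $\Omega$ and satisfies $u=b$ on $\partial\Omega$. Suppose that $u_*\in C(\overline\Omega)$ is a sub-solution of (DP), that $u^*\in C(\overline\Omega)$ is a super-solution of (DP), and that $u_*\le u^*$ in $\Omega$. Then (DP) has a solution $u\in C(\overline\Omega)$ such that $u_*\le u\le u^*$ in $\Omega$. -/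

import Mathlib

namespace InfinityLaplace

noncomputable section

/-- The infinity Laplacian `⟨D²ψ(x) Dψ(x), Dψ(x)⟩`: the second derivative of `ψ` at `x`, a bilinear
form, evaluated twice on the gradient of `ψ` at `x`. -/
def infinityLaplacian {N : ℕ} (ψ : EuclideanSpace ℝ (Fin N) → ℝ)
    (x : EuclideanSpace ℝ (Fin N)) : ℝ :=
  fderiv ℝ (fderiv ℝ ψ) x (gradient ψ x) (gradient ψ x)

/-- `u ∈ C(Ω)` is a viscosity sub-solution of `Δ_∞ u = f(x, u)` in the open set `Ω`. -/
structure IsSubsolution {N : ℕ} (Ω : Set (EuclideanSpace ℝ (Fin N)))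
    (f : EuclideanSpace ℝ (Fin N) → ℝ → ℝ) (u : EuclideanSpace ℝ (Fin N) → ℝ) : Prop where
  continuousOn : ContinuousOn u Ω
  le_infinityLaplacian : ∀ ψ : EuclideanSpace ℝ (Fin N) → ℝ, ContDiffOn ℝ 2 ψ Ω →
    ∀ x₀ ∈ Ω, IsLocalMax (fun x => u x - ψ x) x₀ → f x₀ (u x₀) ≤ infinityLaplacian ψ x₀

/-- `u ∈ C(Ω)` is a viscosity super-solution of `Δ_∞ u = f(x, u)` in the open set `Ω`. -/
structure IsSupersolution {N : ℕ} (Ω : Set (EuclideanSpace ℝ (Fin N)))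
    (f : EuclideanSpace ℝ (Fin N) → ℝ → ℝ) (u : EuclideanSpace ℝ (Fin N) → ℝ) : Prop where
  continuousOn : ContinuousOn u Ω
  infinityLaplacian_le : ∀ ψ : EuclideanSpace ℝ (Fin N) → ℝ, ContDiffOn ℝ 2 ψ Ω →
    ∀ x₀ ∈ Ω, IsLocalMin (fun x => u x - ψ x) x₀ → infinityLaplacian ψ x₀ ≤ f x₀ (u x₀)

/-- `u` is a viscosity solution of `Δ_∞ u = f(x, u)` in `Ω`. -/
def IsViscositySolution {N : ℕ} (Ω : Set (EuclideanSpace ℝ (Fin N)))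
    (f : EuclideanSpace ℝ (Fin N) → ℝ → ℝ) (u : EuclideanSpace ℝ (Fin N) → ℝ) : Prop :=
  IsSubsolution Ω f u ∧ IsSupersolution Ω f u

/-- `w ∈ C(closure Ω)` is a sub-solution of the Dirichlet problem
`Δ_∞ u = f(x, u)` in `Ω`, `u = b` on `∂Ω`. -/
structure IsDirichletSubsolution {N : ℕ} (Ω : Set (EuclideanSpace ℝ (Fin N)))
    (f : EuclideanSpace ℝ (Fin N) → ℝ → ℝ) (b w : EuclideanSpace ℝ (Fin N) → ℝ) : Prop where
  continuousOn_closure : ContinuousOn w (closure Ω)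
  isSubsolution : IsSubsolution Ω f w
  le_boundary : ∀ x ∈ frontier Ω, w x ≤ b x

/-- `v ∈ C(closure Ω)` is a super-solution of the Dirichlet problem
`Δ_∞ u = f(x, u)` in `Ω`, `u = b` on `∂Ω`. -/
structure IsDirichletSupersolution {N : ℕ} (Ω : Set (EuclideanSpace ℝ (Fin N)))
    (f : EuclideanSpace ℝ (Fin N) → ℝ → ℝ) (b v : EuclideanSpace ℝ (Fin N) → ℝ) : Prop where
  continuousOn_closure : ContinuousOn v (closure Ω)
  isSupersolution : IsSupersolution Ω f v
  boundary_le : ∀ x ∈ frontier Ω, b x ≤ v x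

/-- `u ∈ C(closure Ω)` is a viscosity solution of the Dirichlet problem
`Δ_∞ u = f(x, u)` in `Ω`, `u = b` on `∂Ω`. -/
structure IsDirichletSolution {N : ℕ} (Ω : Set (EuclideanSpace ℝ (Fin N)))
    (f : EuclideanSpace ℝ (Fin N) → ℝ → ℝ) (b u : EuclideanSpace ℝ (Fin N) → ℝ) : Prop where
  continuousOn_closure : ContinuousOn u (closure Ω)
  isViscositySolution : IsViscositySolution Ω f u
  eq_boundary : ∀ x ∈ frontier Ω, u x = b x

end

end InfinityLaplace

/-! Perron's method: the solution is the supremum `u` of the sub-solutions of the Dirichlet problem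
trapped between `uLower` and `uUpper`. No comparison principle for the equation is needed, because
the trapping keeps every value of `f` in play within `[-M, M]` and supplies the comparison with
`uUpper`. The analytic input is the cusp `c + K‖x - z‖^(2/3)`, whose infinity Laplacian is `-(8/81)
K³ / ‖x - z‖²`, below `-M` on bounded sets once `K` is large. By the definition of viscosity
sub-solution alone, members of the family stay below such cusps
(`IsSubsolution.le_of_infinityLaplacian_lt`). A cusp at an interior point gives a Hölder bound
uniform over the family, hence continuity of `u`; cusps at boundary points, from above and
(reflected) from below, give `u = b` continuously. If `u` failed to be a sub-solution, a nearly
optimal member would fail too. If it failed to be a super-solution, a small local bump would produce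
a larger member. -/

namespace InfinityLaplace

open Set Filter Topology Metric

/-! ### Second-order calculus on normed spaces -/

section Calculus

variable {F : Type*} [NormedAddCommGroup F] [NormedSpace ℝ F]

theorem eventually_differentiableAt_of_contDiffAt_two {g : F → ℝ} {x : F}
    (hg : ContDiffAt ℝ 2 g x) : ∀ᶠ y in 𝓝 x, DifferentiableAt ℝ g y :=
  (hg.eventually (by simp)).mono fun _ hy => hy.differentiableAt (by simp)

theorem differentiableAt_fderiv_of_contDiffAt_two {g : F → ℝ} {x : F}
    (hg : ContDiffAt ℝ 2 g x) : DifferentiableAt ℝ (fderiv ℝ g) x :=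
  (hg.fderiv_right (m := 1) (by norm_num)).differentiableAt (by simp)

theorem fderiv_fderiv_sub_of_contDiffAt {g h : F → ℝ} {x : F}
    (hg : ContDiffAt ℝ 2 g x) (hh : ContDiffAt ℝ 2 h x) :
    fderiv ℝ (fderiv ℝ (fun y => g y - h y)) x =
      fderiv ℝ (fderiv ℝ g) x - fderiv ℝ (fderiv ℝ h) x := by
  have h1 : fderiv ℝ (fun y => g y - h y) =ᶠ[𝓝 x] fun y => fderiv ℝ g y - fderiv ℝ h y := by
    filter_upwards [eventually_differentiableAt_of_contDiffAt_two hg,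
      eventually_differentiableAt_of_contDiffAt_two hh] with y h1 h2
    exact fderiv_fun_sub h1 h2
  rw [h1.fderiv_eq]
  exact fderiv_fun_sub (differentiableAt_fderiv_of_contDiffAt_two hg)
    (differentiableAt_fderiv_of_contDiffAt_two hh)

theorem fderiv_fderiv_add_of_contDiffAt {g h : F → ℝ} {x : F}
    (hg : ContDiffAt ℝ 2 g x) (hh : ContDiffAt ℝ 2 h x) :
    fderiv ℝ (fderiv ℝ (fun y => g y + h y)) x =
      fderiv ℝ (fderiv ℝ g) x + fderiv ℝ (fderiv ℝ h) x := by
  have h1 : fderiv ℝ (fun y => g y + h y) =ᶠ[𝓝 x] fun y => fderiv ℝ g y + fderiv ℝ h y := by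
    filter_upwards [eventually_differentiableAt_of_contDiffAt_two hg,
      eventually_differentiableAt_of_contDiffAt_two hh] with y h1 h2
    exact fderiv_fun_add h1 h2
  rw [h1.fderiv_eq]
  exact fderiv_fun_add (differentiableAt_fderiv_of_contDiffAt_two hg)
    (differentiableAt_fderiv_of_contDiffAt_two hh)

/-- Second-order necessary condition at a local maximum. -/
theorem fderiv_fderiv_nonpos_of_isLocalMax {g : F → ℝ} {x : F} (hg : ContDiffAt ℝ 2 g x)
    (hmax : IsLocalMax g x) (v : F) : fderiv ℝ (fderiv ℝ g) x v v ≤ 0 := by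
  by_contra! hpos
  have hline : ∀ t : ℝ, HasDerivAt (fun t : ℝ => x + t • v) v t := fun t => by
    simpa using ((hasDerivAt_id t).smul_const v).const_add x
  have hcont : ContinuousAt (fun t : ℝ => x + t • v) 0 := (hline 0).continuousAt
  have hx0 : x + (0 : ℝ) • v = x := by simp
  have hcont' : Tendsto (fun t : ℝ => x + t • v) (𝓝 0) (𝓝 x) := by
    simpa [ContinuousAt] using hcont
  have hd : deriv (fun t : ℝ => g (x + t • v)) =ᶠ[𝓝 0] fun t => fderiv ℝ g (x + t • v) v := by
    filter_upwards [hcont'.eventually (eventually_differentiableAt_of_contDiffAt_two hg)] with t ht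
    exact (ht.hasFDerivAt.comp_hasDerivAt t (hline t)).deriv
  have hdd : deriv (deriv fun t : ℝ => g (x + t • v)) 0 = fderiv ℝ (fderiv ℝ g) x v v := by
    rw [hd.deriv_eq]
    have h2 : HasFDerivAt (fderiv ℝ g) (fderiv ℝ (fderiv ℝ g) x) (x + (0 : ℝ) • v) := by
      rw [hx0]; exact (differentiableAt_fderiv_of_contDiffAt_two hg).hasFDerivAt
    have h3 : HasDerivAt (fun t : ℝ => fderiv ℝ g (x + t • v)) (fderiv ℝ (fderiv ℝ g) x v) 0 :=
      HasFDerivAt.comp_hasDerivAt (f := fun t : ℝ => x + t • v) (0 : ℝ) h2 (hline 0)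
    have h4 := ((ContinuousLinearMap.apply ℝ ℝ v).hasFDerivAt).comp_hasDerivAt (0 : ℝ) h3
    exact h4.deriv
  have hmax' : IsLocalMax (fun t : ℝ => g (x + t • v)) 0 := by
    filter_upwards [hcont'.eventually hmax] with t ht
    simpa using ht
  have hcg : ContinuousAt (fun t : ℝ => g (x + t • v)) 0 := by
    refine ContinuousAt.comp (f := fun t : ℝ => x + t • v) ?_ hcont
    rw [hx0]; exact hg.continuousAt
  -- A positive second derivative would make `0` a local minimum along the line as well; the
  -- restriction is then locally constant and its second derivative vanishes.
  have hmin := isLocalMin_of_deriv_deriv_pos (by rw [hdd]; exact hpos) hmax'.deriv_eq_zero hcg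
  have hconst : (fun t : ℝ => g (x + t • v)) =ᶠ[𝓝 0] fun _ => g (x + (0 : ℝ) • v) := by
    filter_upwards [hmin, hmax'] with t h1 h2 using le_antisymm h2 h1
  have : deriv (deriv fun t : ℝ => g (x + t • v)) 0 = 0 := by
    rw [hconst.deriv.deriv_eq]; simp
  rw [hdd] at this
  exact hpos.ne' this

/-- A function that is `C²` at a point agrees near it with a globally `C²` function. -/
theorem exists_contDiff_eventuallyEq_of_contDiffAt [FiniteDimensional ℝ F] {g : F → ℝ} {x : F}
    (hg : ContDiffAt ℝ 2 g x) :
    ∃ h : F → ℝ, ContDiff ℝ 2 h ∧ h =ᶠ[𝓝 x] g := by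
  have hev := hg.eventually (by simp)
  obtain ⟨χ, hχ, -, hχs, -, hχ1⟩ : ∃ χ : F → ℝ, tsupport χ ⊆ {y | ContDiffAt ℝ 2 g y} ∧
      HasCompactSupport χ ∧ ContDiff ℝ 2 χ ∧ True ∧ χ =ᶠ[𝓝 x] 1 := by
    obtain ⟨r, hr, hrs⟩ := Metric.nhds_basis_closedBall.mem_iff.1 hev
    let χ : ContDiffBump x := ⟨r / 2, r, by positivity, by linarith⟩
    exact ⟨χ, by rw [χ.tsupport_eq]; exact hrs, χ.hasCompactSupport, χ.contDiff, trivial,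
      χ.eventuallyEq_one⟩
  refine ⟨fun y => χ y * g y, contDiff_iff_contDiffAt.2 fun y => ?_, ?_⟩
  · by_cases hy : y ∈ tsupport χ
    · exact hχs.contDiffAt.mul (hχ hy)
    · refine (contDiffAt_const (c := (0 : ℝ))).congr_of_eventuallyEq ?_
      filter_upwards [notMem_tsupport_iff_eventuallyEq.1 hy] with z hz
      simp [hz]
  · filter_upwards [hχ1] with y hy
    simp [hy]

end Calculus

/-! ### The infinity Laplacian and radial functions -/

variable {N : ℕ}

theorem infinityLaplacian_congr {φ ψ : EuclideanSpace ℝ (Fin N) → ℝ}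
    {x : EuclideanSpace ℝ (Fin N)} (h : φ =ᶠ[𝓝 x] ψ) :
    infinityLaplacian φ x = infinityLaplacian ψ x := by
  unfold infinityLaplacian
  rw [h.gradient_eq, h.fderiv.fderiv_eq]

theorem infinityLaplacian_neg (ψ : EuclideanSpace ℝ (Fin N) → ℝ)
    (x : EuclideanSpace ℝ (Fin N)) :
    infinityLaplacian (fun y => -ψ y) x = -infinityLaplacian ψ x := by
  have h1 : fderiv ℝ (fun y => -ψ y) = fun y => -fderiv ℝ ψ y := by
    ext1 y; exact fderiv_fun_neg
  simp [infinityLaplacian, gradient, h1, fderiv_fun_neg]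

theorem infinityLaplacian_eq_of_fderiv {ψ φ : EuclideanSpace ℝ (Fin N) → ℝ}
    {x : EuclideanSpace ℝ (Fin N)} (h : fderiv ℝ ψ x = fderiv ℝ φ x)
    (h' : fderiv ℝ (fderiv ℝ ψ) x = fderiv ℝ (fderiv ℝ φ) x) :
    infinityLaplacian ψ x = infinityLaplacian φ x := by
  simp [infinityLaplacian, gradient, h, h']

/-- Degenerate ellipticity: at the contact point the gradients coincide and the Hessians are ordered
in that common direction. -/
theorem infinityLaplacian_le_of_isLocalMax {φ ψ : EuclideanSpace ℝ (Fin N) → ℝ}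
    {x : EuclideanSpace ℝ (Fin N)} (hφ : ContDiffAt ℝ 2 φ x) (hψ : ContDiffAt ℝ 2 ψ x)
    (hmax : IsLocalMax (fun y => φ y - ψ y) x) :
    infinityLaplacian φ x ≤ infinityLaplacian ψ x := by
  have h1 : fderiv ℝ φ x = fderiv ℝ ψ x := by
    have := hmax.fderiv_eq_zero
    rw [fderiv_fun_sub (hφ.differentiableAt (by simp)) (hψ.differentiableAt (by simp))] at this
    exact sub_eq_zero.1 this
  have h2 := fderiv_fderiv_nonpos_of_isLocalMax (hφ.sub hψ) hmax (gradient ψ x)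
  rw [fderiv_fderiv_sub_of_contDiffAt hφ hψ] at h2
  have h3 : gradient φ x = gradient ψ x := by simp [gradient, h1]
  rw [infinityLaplacian, infinityLaplacian, h3]
  simpa using h2

theorem continuousAt_infinityLaplacian {ψ : EuclideanSpace ℝ (Fin N) → ℝ}
    {x : EuclideanSpace ℝ (Fin N)} (hψ : ContDiffAt ℝ 2 ψ x) :
    ContinuousAt (infinityLaplacian ψ) x := by
  have h1 : ContDiffAt ℝ 1 (fderiv ℝ ψ) x := hψ.fderiv_right (by norm_num)
  have h2 : ContinuousAt (fderiv ℝ (fderiv ℝ ψ)) x :=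
    (h1.fderiv_right (m := 0) (by norm_num)).continuousAt
  have h3 : ContinuousAt (gradient ψ) x := by
    unfold gradient
    exact (LinearIsometryEquiv.continuous _).continuousAt.comp h1.continuousAt
  exact (h2.clm_apply h3).clm_apply h3

/-- First derivative of a radial function. -/
theorem hasFDerivAt_radial {h : ℝ → ℝ} {h' : ℝ} {x z : EuclideanSpace ℝ (Fin N)}
    (hh : HasDerivAt h h' (‖x - z‖ ^ 2)) :
    HasFDerivAt (fun y => h (‖y - z‖ ^ 2)) ((2 * h') • innerSL ℝ (x - z)) x := by
  have h1 := ((hasFDerivAt_id x).sub_const z).norm_sq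
  have h2 := hh.comp_hasFDerivAt x h1
  refine h2.congr_fderiv ?_
  ext v
  simp
  ring

theorem gradient_radial {h : ℝ → ℝ} {h' : ℝ} {x z : EuclideanSpace ℝ (Fin N)}
    (hh : HasDerivAt h h' (‖x - z‖ ^ 2)) :
    gradient (fun y => h (‖y - z‖ ^ 2)) x = (2 * h') • (x - z) := by
  rw [gradient, (hasFDerivAt_radial hh).fderiv]
  apply (InnerProductSpace.toDual ℝ (EuclideanSpace ℝ (Fin N))).injective
  ext v
  simp

/-- Second derivative of a radial function. -/
theorem fderiv_fderiv_radial {h h' : ℝ → ℝ} {h'' : ℝ} {x z : EuclideanSpace ℝ (Fin N)}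
    (hh : ∀ᶠ s in 𝓝 (‖x - z‖ ^ 2), HasDerivAt h (h' s) s)
    (hh' : HasDerivAt h' h'' (‖x - z‖ ^ 2)) (v w : EuclideanSpace ℝ (Fin N)) :
    fderiv ℝ (fderiv ℝ fun y => h (‖y - z‖ ^ 2)) x v w =
      2 * h' (‖x - z‖ ^ 2) * inner ℝ v w + 4 * h'' * inner ℝ (x - z) v * inner ℝ (x - z) w := by
  have hc : Tendsto (fun y : EuclideanSpace ℝ (Fin N) => ‖y - z‖ ^ 2) (𝓝 x)
      (𝓝 (‖x - z‖ ^ 2)) :=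
    Continuous.tendsto (by fun_prop) x
  have h1 : (fderiv ℝ fun y => h (‖y - z‖ ^ 2)) =ᶠ[𝓝 x]
      fun y => (2 * h' (‖y - z‖ ^ 2)) • innerSL ℝ (y - z) := by
    filter_upwards [hc.eventually hh] with y hy using (hasFDerivAt_radial hy).fderiv
  have h2 : HasFDerivAt (fun y => 2 * h' (‖y - z‖ ^ 2)) _ x :=
    (hasFDerivAt_radial hh').const_mul 2
  have h3 : HasFDerivAt (fun y : EuclideanSpace ℝ (Fin N) => innerSL ℝ (y - z)) _ x :=
    ((innerSL ℝ (E := EuclideanSpace ℝ (Fin N))).hasFDerivAt).comp x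
      ((hasFDerivAt_id x).sub_const z)
  rw [h1.fderiv_eq, (h2.fun_smul h3).fderiv]
  have e : innerSL ℝ v w = inner ℝ v w := rfl
  simp only [add_apply, smul_apply,
    ContinuousLinearMap.smulRight_apply, ContinuousLinearMap.comp_apply,
    ContinuousLinearMap.id_apply, innerSL_apply_apply, smul_eq_mul, e]
  ring

theorem infinityLaplacian_radial {h h' : ℝ → ℝ} {h'' : ℝ} {x z : EuclideanSpace ℝ (Fin N)}
    (hh : ∀ᶠ s in 𝓝 (‖x - z‖ ^ 2), HasDerivAt h (h' s) s)
    (hh' : HasDerivAt h' h'' (‖x - z‖ ^ 2)) :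
    infinityLaplacian (fun y => h (‖y - z‖ ^ 2)) x =
      8 * h' (‖x - z‖ ^ 2) ^ 2 * ‖x - z‖ ^ 2 *
        (h' (‖x - z‖ ^ 2) + 2 * h'' * ‖x - z‖ ^ 2) := by
  rw [infinityLaplacian, fderiv_fderiv_radial hh hh', gradient_radial hh.self_of_nhds]
  rw [real_inner_smul_left, real_inner_smul_right, real_inner_self_eq_norm_sq]
  ring

theorem contDiff_norm_sub_pow_four (z : EuclideanSpace ℝ (Fin N)) :
    ContDiff ℝ 2 fun y => ‖y - z‖ ^ 4 := by
  have : ContDiff ℝ 2 fun y => (‖y - z‖ ^ 2) ^ 2 :=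
    ((contDiff_id.sub contDiff_const).norm_sq ℝ).pow 2
  simpa [← pow_mul] using this

/-- Adding a multiple of `‖x - z‖⁴` and a constant does not change the infinity Laplacian at `z`. -/
theorem infinityLaplacian_add_quartic {ψ : EuclideanSpace ℝ (Fin N) → ℝ}
    {z : EuclideanSpace ℝ (Fin N)} (hψ : ContDiffAt ℝ 2 ψ z) (a : ℝ) :
    infinityLaplacian (fun y => ψ y + a * ‖y - z‖ ^ 4) z = infinityLaplacian ψ z := by
  have hd : ∀ s : ℝ, HasDerivAt (fun s : ℝ => a * s ^ 2) (a * (2 * s)) s := fun s => by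
    simpa using (hasDerivAt_pow 2 s).const_mul a
  have hd' : ∀ s : ℝ, HasDerivAt (fun s : ℝ => a * (2 * s)) (a * 2) s := fun s => by
    simpa using ((hasDerivAt_id s).const_mul 2).const_mul a
  have heq : (fun y => a * ‖y - z‖ ^ 4) = fun y => a * (‖y - z‖ ^ 2) ^ 2 := by
    ext1 y; rw [← pow_mul]
  have hq : ContDiffAt ℝ 2 (fun y => a * ‖y - z‖ ^ 4) z :=
    (contDiff_const.mul (contDiff_norm_sub_pow_four z)).contDiffAt
  have h1 : fderiv ℝ (fun y => a * ‖y - z‖ ^ 4) z = 0 := by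
    rw [heq, (hasFDerivAt_radial (hd _)).fderiv]; simp
  have h2 : fderiv ℝ (fderiv ℝ fun y => a * ‖y - z‖ ^ 4) z = 0 := by
    ext v w
    rw [heq, fderiv_fderiv_radial (Eventually.of_forall hd) (hd' _)]; simp
  apply infinityLaplacian_eq_of_fderiv
  · rw [fderiv_fun_add (hψ.differentiableAt (by simp)) (hq.differentiableAt (by simp)), h1,
      add_zero]
  · rw [fderiv_fderiv_add_of_contDiffAt hψ hq, h2, add_zero]

theorem infinityLaplacian_add_const (ψ : EuclideanSpace ℝ (Fin N) → ℝ)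
    (z : EuclideanSpace ℝ (Fin N)) (c : ℝ) :
    infinityLaplacian (fun y => ψ y + c) z = infinityLaplacian ψ z := by
  have : fderiv ℝ (fun y => ψ y + c) = fderiv ℝ ψ := by
    ext1 y; exact fderiv_add_const c
  exact infinityLaplacian_eq_of_fderiv (by rw [this]) (by rw [this])

/-! ### The cusp barrier -/

/-- The barrier `c + K ‖x - z‖^(2/3)`. -/
noncomputable def barrier (c K : ℝ) (z x : EuclideanSpace ℝ (Fin N)) : ℝ :=
  c + K * (‖x - z‖ ^ 2) ^ (1 / 3 : ℝ)

theorem barrier_self (c K : ℝ) (z : EuclideanSpace ℝ (Fin N)) : barrier c K z z = c := by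
  simp [barrier]

theorem continuous_barrier (c K : ℝ) (z : EuclideanSpace ℝ (Fin N)) :
    Continuous (barrier c K z) := by
  unfold barrier
  refine continuous_const.add (continuous_const.mul (Continuous.rpow_const (by fun_prop) ?_))
  intro x; right; norm_num

theorem le_barrier {c K : ℝ} (hK : 0 ≤ K) (z x : EuclideanSpace ℝ (Fin N)) :
    c ≤ barrier c K z x := by
  have : 0 ≤ K * (‖x - z‖ ^ 2) ^ (1 / 3 : ℝ) := by positivity
  unfold barrier; linarith

theorem contDiffAt_barrier (c K : ℝ) {z x : EuclideanSpace ℝ (Fin N)} (hx : x ≠ z) :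
    ContDiffAt ℝ 2 (barrier c K z) x := by
  have hpos : ‖x - z‖ ^ 2 ≠ 0 := by simpa [sub_eq_zero] using hx
  exact contDiffAt_const.add (contDiffAt_const.mul
    (((contDiffAt_id.sub contDiffAt_const).norm_sq ℝ).rpow_const_of_ne hpos))

/-- With `h s = c + K s^(1/3)` the radial factor `h' + 2 s h''` equals `(1/3 - 4/9) K s^(-2/3)`,
negative for `K > 0`; the exponent makes the remaining powers collapse to `1 / s`. -/
theorem infinityLaplacian_barrier (c K : ℝ) {z x : EuclideanSpace ℝ (Fin N)} (hx : x ≠ z) :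
    infinityLaplacian (barrier c K z) x = -(8 / 81 * K ^ 3) / ‖x - z‖ ^ 2 := by
  have hpos : 0 < ‖x - z‖ ^ 2 := by
    have : 0 < ‖x - z‖ := by simpa [sub_eq_zero] using hx
    positivity
  have hd : ∀ᶠ s in 𝓝 (‖x - z‖ ^ 2), HasDerivAt (fun s : ℝ => c + K * s ^ (1 / 3 : ℝ))
      (K * (1 / 3 * s ^ (-2 / 3 : ℝ))) s := by
    filter_upwards [lt_mem_nhds hpos] with s hs
    have := ((Real.hasDerivAt_rpow_const (p := 1 / 3) (Or.inl hs.ne')).const_mul K).const_add c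
    norm_num at this ⊢
    exact this
  have hd' : HasDerivAt (fun s : ℝ => K * (1 / 3 * s ^ (-2 / 3 : ℝ)))
      (K * (1 / 3 * (-2 / 3 * (‖x - z‖ ^ 2) ^ (-5 / 3 : ℝ)))) (‖x - z‖ ^ 2) := by
    have := ((Real.hasDerivAt_rpow_const (p := -2 / 3) (Or.inl hpos.ne')).const_mul
      (1 / 3)).const_mul K
    norm_num at this ⊢
    exact this
  have key := infinityLaplacian_radial (x := x) (z := z) hd hd'
  have hb : barrier c K z = fun y => c + K * (‖y - z‖ ^ 2) ^ (1 / 3 : ℝ) := rfl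
  rw [hb, key]
  set s := ‖x - z‖ ^ 2
  have e1 : s ^ (-5 / 3 : ℝ) = s ^ (-2 / 3 : ℝ) / s := by
    rw [← Real.rpow_sub_one hpos.ne']; norm_num
  have e2 : (s ^ (-2 / 3 : ℝ)) ^ 3 = 1 / s ^ 2 := by
    rw [← Real.rpow_natCast, ← Real.rpow_mul hpos.le]
    norm_num
  have : s * (s ^ (-2 / 3 : ℝ)) ^ 3 = 1 / s := by rw [e2]; field_simp
  rw [e1]
  generalize s ^ (-2 / 3 : ℝ) = p at *
  have e3 : 2 * (K * (1 / 3 * (-2 / 3 * (p / s)))) * s = - (4 / 9) * K * p := by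
    field_simp; ring
  rw [e3]
  have : 8 * (K * (1 / 3 * p)) ^ 2 * s * (K * (1 / 3 * p) + - (4 / 9) * K * p)
      = -(8 / 81 * K ^ 3) * (s * p ^ 3) := by ring
  rw [this, ‹s * p ^ 3 = 1 / s›]
  ring

/-- For large `K` the barrier has very negative infinity Laplacian on a bounded punctured ball. -/
theorem exists_infinityLaplacian_barrier_lt (M R : ℝ) :
    ∃ K₀ : ℝ, 0 < K₀ ∧ ∀ K, K₀ ≤ K → ∀ c : ℝ, ∀ z x : EuclideanSpace ℝ (Fin N), x ≠ z →
      ‖x - z‖ ≤ R → infinityLaplacian (barrier c K z) x < -M := by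
  -- The summand `1` ensures `K ≤ K³`, so `8/81 K³` exceeds `|M| R²`.
  refine ⟨1 + 81 / 8 * (|M| * R ^ 2 + 1), by positivity, fun K hK c z x hx hR => ?_⟩
  rw [infinityLaplacian_barrier c K hx]
  have h0 : 0 < ‖x - z‖ := by simpa [sub_eq_zero] using hx
  have hs : ‖x - z‖ ^ 2 ≤ R ^ 2 := by gcongr
  have hM : M * ‖x - z‖ ^ 2 ≤ |M| * R ^ 2 := by
    have := le_abs_self M
    gcongr
  have hK1 : 1 ≤ K := by
    have : 0 ≤ |M| * R ^ 2 := by positivity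
    linarith
  have hK3 : K ≤ K ^ 3 := le_self_pow₀ hK1 (by norm_num)
  rw [neg_div, neg_lt_neg_iff, lt_div_iff₀ (by positivity)]
  linarith

/-! ### Comparison and Hölder estimates for sub-solutions -/

/-- Test functions for sub-solutions need only be `C²` at the point of contact. -/
theorem IsSubsolution.le_of_contDiffAt {Ω : Set (EuclideanSpace ℝ (Fin N))}
    {f : EuclideanSpace ℝ (Fin N) → ℝ → ℝ} {w ψ : EuclideanSpace ℝ (Fin N) → ℝ}
    {x₀ : EuclideanSpace ℝ (Fin N)} (hw : IsSubsolution Ω f w) (hx₀ : x₀ ∈ Ω)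
    (hψ : ContDiffAt ℝ 2 ψ x₀) (hmax : IsLocalMax (fun x => w x - ψ x) x₀) :
    f x₀ (w x₀) ≤ infinityLaplacian ψ x₀ := by
  obtain ⟨φ, hφ, hφψ⟩ := exists_contDiff_eventuallyEq_of_contDiffAt hψ
  rw [← infinityLaplacian_congr hφψ]
  refine hw.le_infinityLaplacian φ hφ.contDiffOn x₀ hx₀ ?_
  filter_upwards [hmax, hφψ] with x hx hx'
  simpa [hx', hφψ.self_of_nhds] using hx

/-- The operator is odd, so reflection lets the comparison lemma for sub-solutions serve
super-solutions too. -/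
theorem IsSupersolution.neg {Ω : Set (EuclideanSpace ℝ (Fin N))}
    {f : EuclideanSpace ℝ (Fin N) → ℝ → ℝ} {v : EuclideanSpace ℝ (Fin N) → ℝ}
    (hv : IsSupersolution Ω f v) : IsSubsolution Ω (fun x t => -f x (-t)) (fun x => -v x) where
  continuousOn := hv.continuousOn.neg
  le_infinityLaplacian ψ hψ x₀ hx₀ hmax := by
    have h := hv.infinityLaplacian_le (fun x => -ψ x) hψ.neg x₀ hx₀ (by
      filter_upwards [hmax] with x hx
      linarith)
    rw [infinityLaplacian_neg] at h
    simp only [neg_neg]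
    linarith

/-- Comparison of a sub-solution with a classical strict super-solution. -/
theorem IsSubsolution.le_of_infinityLaplacian_lt {Ω A U : Set (EuclideanSpace ℝ (Fin N))}
    {f : EuclideanSpace ℝ (Fin N) → ℝ → ℝ} {w φ : EuclideanSpace ℝ (Fin N) → ℝ}
    (hw : IsSubsolution Ω f w) (hA : IsCompact A) (hwA : ContinuousOn w A)
    (hφA : ContinuousOn φ A) (hU : IsOpen U) (hUA : U ⊆ A) (hUΩ : U ⊆ Ω)
    (hφ : ∀ x ∈ U, ContDiffAt ℝ 2 φ x) (hlt : ∀ x ∈ U, infinityLaplacian φ x < f x (w x))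
    (hbd : ∀ x ∈ A, x ∉ U → w x ≤ φ x) : ∀ x ∈ A, w x ≤ φ x := by
  intro x hx
  obtain ⟨y, hy, hmax⟩ := hA.exists_isMaxOn ⟨x, hx⟩ (hwA.sub hφA)
  have hxy : w x - φ x ≤ w y - φ y := hmax hx
  by_cases hyU : y ∈ U
  · have := hw.le_of_contDiffAt (hUΩ hyU) (hφ y hyU)
      (hmax.isLocalMax (mem_of_superset (hU.mem_nhds hyU) hUA))
    exact absurd (hlt y hyU) (not_lt.2 this)
  · linarith [hbd y hy hyU]

/-- Interior Hölder estimate for bounded sub-solutions with bounded right-hand side. -/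
theorem IsSubsolution.exists_le_barrier (C M : ℝ) {R : ℝ} (hR : 0 < R) :
    ∃ K : ℝ, ∀ (Ω : Set (EuclideanSpace ℝ (Fin N))) (f : EuclideanSpace ℝ (Fin N) → ℝ → ℝ)
      (w : EuclideanSpace ℝ (Fin N) → ℝ) (x : EuclideanSpace ℝ (Fin N)),
      IsSubsolution Ω f w → closedBall x R ⊆ Ω → (∀ y ∈ Ω, -M ≤ f y (w y)) →
      (∀ y ∈ Ω, |w y| ≤ C) → ∀ y ∈ closedBall x R, w y ≤ barrier (w x) K x y := by
  obtain ⟨K₀, hK₀, hK⟩ := exists_infinityLaplacian_barrier_lt (N := N) M R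
  have hRp : 0 < (R ^ 2) ^ (1 / 3 : ℝ) := by positivity
  -- `K₀` gives the strict inequality for the operator; the second entry lifts the barrier by at
  -- least `2C` on the sphere of radius `R`.
  refine ⟨max K₀ (2 * C / (R ^ 2) ^ (1 / 3 : ℝ)), fun Ω f w x hw hball hM hC => ?_⟩
  -- The centre, where the cusp is singular, is treated as a boundary point: both sides agree there.
  refine hw.le_of_infinityLaplacian_lt (U := ball x R \ {x}) (isCompact_closedBall x R)
    (hw.continuousOn.mono hball) (continuous_barrier _ _ _).continuousOn
    (isOpen_ball.sdiff isClosed_singleton)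
    (sdiff_subset.trans ball_subset_closedBall)
    ((sdiff_subset.trans ball_subset_closedBall).trans hball)
    (fun y hy => contDiffAt_barrier _ _ hy.2) (fun y hy => ?_) (fun y hy hyU => ?_)
  · refine (hK _ (le_max_left _ _) _ x y hy.2 ?_).trans_le
      (hM y (hball (ball_subset_closedBall hy.1)))
    rw [← dist_eq_norm]; exact (mem_ball.1 hy.1).le
  · by_cases hyx : y = x
    · rw [hyx, barrier_self]
    · have hyR : ‖y - x‖ = R := by
        rw [← dist_eq_norm]
        refine le_antisymm (mem_closedBall.1 hy) (not_lt.1 fun h => hyU ⟨h, hyx⟩)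
      have h1 := abs_le.1 (hC y (hball hy))
      have h2 := abs_le.1 (hC x (hball (mem_closedBall_self hR.le)))
      have h3 : 2 * C ≤ max K₀ (2 * C / (R ^ 2) ^ (1 / 3 : ℝ)) * (R ^ 2) ^ (1 / 3 : ℝ) :=
        (div_le_iff₀ hRp).1 (le_max_right _ _)
      rw [barrier, hyR]
      linarith [h1.2, h2.1]

/-- A continuous function above a sub-solution, which at each point of strict inequality is touched
from below by a classical sub-solution, is a sub-solution. -/
theorem IsSubsolution.of_touching {Ω : Set (EuclideanSpace ℝ (Fin N))}
    {f : EuclideanSpace ℝ (Fin N) → ℝ → ℝ} {w v : EuclideanSpace ℝ (Fin N) → ℝ}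
    (hΩ : IsOpen Ω) (hw : IsSubsolution Ω f w) (hv : ContinuousOn v Ω)
    (hwv : ∀ x ∈ Ω, w x ≤ v x)
    (h : ∀ x ∈ Ω, w x < v x → ∃ φ : EuclideanSpace ℝ (Fin N) → ℝ, ContDiffAt ℝ 2 φ x ∧
      φ x = v x ∧ φ ≤ᶠ[𝓝 x] v ∧ f x (v x) ≤ infinityLaplacian φ x) :
    IsSubsolution Ω f v where
  continuousOn := hv
  le_infinityLaplacian ψ hψ x₀ hx₀ hmax := by
    -- At equality a function touching `v` from above also touches `w`; otherwise it touches the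
    -- classical sub-solution `φ`, and ellipticity applies.
    rcases (hwv x₀ hx₀).eq_or_lt with heq | hlt
    · rw [← heq]
      refine hw.le_infinityLaplacian ψ hψ x₀ hx₀ ?_
      filter_upwards [hmax, hΩ.mem_nhds hx₀] with x hx hxΩ
      linarith [hwv x hxΩ]
    · obtain ⟨φ, hφ, hφx, hφv, hle⟩ := h x₀ hx₀ hlt
      refine hle.trans (infinityLaplacian_le_of_isLocalMax hφ
        (hψ.contDiffAt (hΩ.mem_nhds hx₀)) ?_)
      filter_upwards [hmax, hφv] with x hx hx'
      linarith

/-- Near `z` continuity costs at most `ε`; away from `z` the cusp exceeds the oscillation `2C`.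
Stating it for all larger `K` allows other constraints on `K`. -/
theorem exists_le_barrier_of_continuousOn {S : Set (EuclideanSpace ℝ (Fin N))}
    (hS : IsCompact S) {b : EuclideanSpace ℝ (Fin N) → ℝ} (hb : ContinuousOn b S)
    {z : EuclideanSpace ℝ (Fin N)} (hz : z ∈ S) {ε : ℝ} (hε : 0 < ε) :
    ∃ K₀ : ℝ, 0 < K₀ ∧ ∀ K, K₀ ≤ K → ∀ x ∈ S, b x ≤ barrier (b z + ε) K z x := by
  obtain ⟨C, hC⟩ := hS.exists_bound_of_continuousOn hb
  obtain ⟨δ, hδ, hbδ⟩ := Metric.continuousWithinAt_iff.1 (hb z hz) ε hε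
  have hδp : 0 < (δ ^ 2) ^ (1 / 3 : ℝ) := by positivity
  have hC0 : 0 ≤ C := (norm_nonneg _).trans (hC z hz)
  refine ⟨1 + 2 * C / (δ ^ 2) ^ (1 / 3 : ℝ), by positivity, fun K hK x hx => ?_⟩
  have hK0 : 0 ≤ K := le_trans (by positivity) hK
  by_cases hxz : dist x z < δ
  · have := (abs_lt.1 (Real.dist_eq _ _ ▸ hbδ hx hxz)).2
    exact le_trans (by linarith) (le_barrier hK0 z x)
  · have h1 := abs_le.1 (Real.norm_eq_abs _ ▸ hC x hx)
    have h2 := abs_le.1 (Real.norm_eq_abs _ ▸ hC z hz)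
    have h3 : δ ≤ ‖x - z‖ := by rw [← dist_eq_norm]; exact not_lt.1 hxz
    have h4 : 2 * C ≤ K * (δ ^ 2) ^ (1 / 3 : ℝ) := (div_le_iff₀ hδp).1 (by linarith)
    have h5 : K * (δ ^ 2) ^ (1 / 3 : ℝ) ≤ K * (‖x - z‖ ^ 2) ^ (1 / 3 : ℝ) := by gcongr
    rw [barrier]
    linarith [h1.2, h2.1]

/-! ### The Perron family, and continuity of its supremum -/

/-- The sub-solutions of the Dirichlet problem lying between `lo` and `up`. -/
def perronFamily (Ω : Set (EuclideanSpace ℝ (Fin N))) (f : EuclideanSpace ℝ (Fin N) → ℝ → ℝ)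
    (b lo up : EuclideanSpace ℝ (Fin N) → ℝ) : Set (EuclideanSpace ℝ (Fin N) → ℝ) :=
  {w | IsDirichletSubsolution Ω f b w ∧ ∀ x ∈ closure Ω, lo x ≤ w x ∧ w x ≤ up x}

/-- The pointwise supremum of the Perron family. -/
noncomputable def perronSup (Ω : Set (EuclideanSpace ℝ (Fin N)))
    (f : EuclideanSpace ℝ (Fin N) → ℝ → ℝ) (b lo up : EuclideanSpace ℝ (Fin N) → ℝ)
    (x : EuclideanSpace ℝ (Fin N)) : ℝ :=
  sSup ((fun w => w x) '' perronFamily Ω f b lo up)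

section Perron

variable {Ω : Set (EuclideanSpace ℝ (Fin N))} {f : EuclideanSpace ℝ (Fin N) → ℝ → ℝ}
  {b lo up : EuclideanSpace ℝ (Fin N) → ℝ}

theorem le_perronSup {w : EuclideanSpace ℝ (Fin N) → ℝ} (hw : w ∈ perronFamily Ω f b lo up)
    {x : EuclideanSpace ℝ (Fin N)} (hx : x ∈ closure Ω) : w x ≤ perronSup Ω f b lo up x :=
  le_csSup ⟨up x, by rintro _ ⟨v, hv, rfl⟩; exact (hv.2 x hx).2⟩ ⟨w, hw, rfl⟩

theorem perronSup_le (hne : (perronFamily Ω f b lo up).Nonempty)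
    {x : EuclideanSpace ℝ (Fin N)} {c : ℝ} (h : ∀ w ∈ perronFamily Ω f b lo up, w x ≤ c) :
    perronSup Ω f b lo up x ≤ c :=
  csSup_le (hne.image _) (by rintro _ ⟨w, hw, rfl⟩; exact h w hw)

theorem exists_lt_of_lt_perronSup (hne : (perronFamily Ω f b lo up).Nonempty)
    {x : EuclideanSpace ℝ (Fin N)} {c : ℝ} (h : c < perronSup Ω f b lo up x) :
    ∃ w ∈ perronFamily Ω f b lo up, c < w x := by
  obtain ⟨_, ⟨w, hw, rfl⟩, hc⟩ := exists_lt_of_lt_csSup (hne.image _) h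
  exact ⟨w, hw, hc⟩

theorem lower_mem_perronFamily (hΩ : IsOpen Ω) (hlo : IsDirichletSubsolution Ω f b lo)
    (hup : IsDirichletSupersolution Ω f b up) (hle : ∀ x ∈ Ω, lo x ≤ up x) :
    lo ∈ perronFamily Ω f b lo up := by
  refine ⟨hlo, fun x hx => ⟨le_rfl, ?_⟩⟩
  by_cases hxΩ : x ∈ Ω
  · exact hle x hxΩ
  · have hxf : x ∈ frontier Ω := by rw [hΩ.frontier_eq]; exact ⟨hx, hxΩ⟩
    exact (hlo.le_boundary x hxf).trans (hup.boundary_le x hxf)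

/-- The two obstacles are bounded on the compact closure, so a single pair of constants serves the
whole family. -/
theorem exists_bounds (hbdd : Bornology.IsBounded Ω)
    (hf_bdd : ∀ c d : ℝ, ∃ M : ℝ, ∀ x ∈ Ω, ∀ t ∈ Icc c d, |f x t| ≤ M)
    (hlo : IsDirichletSubsolution Ω f b lo) (hup : IsDirichletSupersolution Ω f b up) :
    ∃ C M : ℝ, ∀ x ∈ Ω, ∀ t, lo x ≤ t → t ≤ up x → |t| ≤ C ∧ |f x t| ≤ M := by
  have hc : IsCompact (closure Ω) := hbdd.isCompact_closure
  obtain ⟨C₁, h₁⟩ := hc.exists_bound_of_continuousOn hlo.continuousOn_closure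
  obtain ⟨C₂, h₂⟩ := hc.exists_bound_of_continuousOn hup.continuousOn_closure
  obtain ⟨M, hM⟩ := hf_bdd (-max C₁ C₂) (max C₁ C₂)
  refine ⟨max C₁ C₂, M, fun x hx t hlt htu => ?_⟩
  have e1 := abs_le.1 (Real.norm_eq_abs _ ▸ h₁ x (subset_closure hx))
  have e2 := abs_le.1 (Real.norm_eq_abs _ ▸ h₂ x (subset_closure hx))
  have e3 : -max C₁ C₂ ≤ t := by linarith [le_max_left C₁ C₂, e1.1]
  have e4 : t ≤ max C₁ C₂ := by linarith [le_max_right C₁ C₂, e2.2]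
  exact ⟨abs_le.2 ⟨e3, e4⟩, hM x hx t ⟨e3, e4⟩⟩

/-- The Perron supremum is continuous in the interior. -/
theorem continuousAt_perronSup (hΩ : IsOpen Ω) {C M : ℝ}
    (hne : (perronFamily Ω f b lo up).Nonempty)
    (hCM : ∀ x ∈ Ω, ∀ t, lo x ≤ t → t ≤ up x → |t| ≤ C ∧ |f x t| ≤ M)
    {x : EuclideanSpace ℝ (Fin N)} (hx : x ∈ Ω) :
    ContinuousAt (perronSup Ω f b lo up) x := by
  obtain ⟨R, hR, hRΩ⟩ := Metric.nhds_basis_closedBall.mem_iff.1 (hΩ.mem_nhds hx)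
  -- Half the radius leaves room to centre the cusp at any `y` near `x` with the same `K`;
  -- exchanging `x` and `y` then bounds the difference on both sides.
  obtain ⟨K, hK⟩ := IsSubsolution.exists_le_barrier (N := N) C M (half_pos hR)
  have key : ∀ y z, closedBall y (R / 2) ⊆ Ω → z ∈ closedBall y (R / 2) →
      perronSup Ω f b lo up z ≤ barrier (perronSup Ω f b lo up y) K y z := by
    intro y z hy hz
    refine perronSup_le hne fun w hw => ?_
    have hval : ∀ p ∈ Ω, |w p| ≤ C ∧ |f p (w p)| ≤ M := fun p hp =>
      hCM p hp _ (hw.2 p (subset_closure hp)).1 (hw.2 p (subset_closure hp)).2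
    have h1 := hK Ω f w y hw.1.isSubsolution hy (fun p hp => (abs_le.1 (hval p hp).2).1)
      (fun p hp => (hval p hp).1) z hz
    have h2 := le_perronSup hw (subset_closure (hy (mem_closedBall_self (by positivity))))
    unfold barrier at h1 ⊢
    linarith
  have hlim : Tendsto (fun y : EuclideanSpace ℝ (Fin N) => K * (‖y - x‖ ^ 2) ^ (1 / 3 : ℝ))
      (𝓝 x) (𝓝 0) := by
    have h := (continuous_barrier 0 K x).tendsto x
    rw [barrier_self] at h
    refine h.congr fun y => ?_
    rw [barrier, zero_add]
  rw [ContinuousAt, tendsto_iff_dist_tendsto_zero]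
  refine squeeze_zero' (Eventually.of_forall fun _ => dist_nonneg) ?_ hlim
  filter_upwards [closedBall_mem_nhds x (half_pos hR)] with y hy
  have h1 := key x y ((closedBall_subset_closedBall (by linarith)).trans hRΩ) hy
  have h2 := key y x ((closedBall_subset_closedBall' (by linarith [mem_closedBall.1 hy])).trans hRΩ)
    (mem_closedBall_comm.1 hy)
  unfold barrier at h1 h2
  rw [norm_sub_rev x y] at h2
  rw [Real.dist_eq, abs_le]
  constructor <;> linarith

/-- Upper barrier at a boundary point. -/
theorem perronSup_le_barrier (hΩ : IsOpen Ω) (hbdd : Bornology.IsBounded Ω) {C M : ℝ}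
    (hb : ContinuousOn b (frontier Ω)) (hne : (perronFamily Ω f b lo up).Nonempty)
    (hCM : ∀ x ∈ Ω, ∀ t, lo x ≤ t → t ≤ up x → |t| ≤ C ∧ |f x t| ≤ M)
    {z : EuclideanSpace ℝ (Fin N)} (hz : z ∈ frontier Ω) {ε : ℝ} (hε : 0 < ε) :
    ∃ K : ℝ, ∀ x ∈ closure Ω, perronSup Ω f b lo up x ≤ barrier (b z + ε) K z x := by
  obtain ⟨K₁, hK₁, h₁⟩ := exists_infinityLaplacian_barrier_lt (N := N) M (diam (closure Ω))
  obtain ⟨K₂, hK₂, h₂⟩ := exists_le_barrier_of_continuousOn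
    (hbdd.isCompact_closure.of_isClosed_subset isClosed_frontier frontier_subset_closure) hb hz hε
  have hzΩ : ∀ x ∈ Ω, x ≠ z := by
    rintro x hx rfl
    rw [hΩ.frontier_eq] at hz
    exact hz.2 hx
  refine ⟨max K₁ K₂, fun x hx => perronSup_le hne fun w hw => ?_⟩
  refine hw.1.isSubsolution.le_of_infinityLaplacian_lt hbdd.isCompact_closure
    hw.1.continuousOn_closure (continuous_barrier _ _ _).continuousOn hΩ subset_closure
    Subset.rfl (fun y hy => contDiffAt_barrier _ _ (hzΩ y hy)) (fun y hy => ?_)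
    (fun y hy hyΩ => ?_) x hx
  · refine (h₁ _ (le_max_left _ _) _ z y (hzΩ y hy) ?_).trans_le ?_
    · rw [← dist_eq_norm]
      exact dist_le_diam_of_mem hbdd.isCompact_closure.isBounded (subset_closure hy)
        (frontier_subset_closure hz)
    · have h := hw.2 y (subset_closure hy)
      exact (abs_le.1 (hCM y hy _ h.1 h.2).2).1
  · have hyf : y ∈ frontier Ω := by rw [hΩ.frontier_eq]; exact ⟨hy, hyΩ⟩
    exact (hw.1.le_boundary y hyf).trans (h₂ _ (le_max_right _ _) y hyf)

/-- Lower barrier at a boundary point. -/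
theorem neg_barrier_le_perronSup (hΩ : IsOpen Ω) (hbdd : Bornology.IsBounded Ω) {C M : ℝ}
    (hb : ContinuousOn b (frontier Ω)) (hlo : IsDirichletSubsolution Ω f b lo)
    (hup : IsDirichletSupersolution Ω f b up) (hle : ∀ x ∈ Ω, lo x ≤ up x)
    (hCM : ∀ x ∈ Ω, ∀ t, lo x ≤ t → t ≤ up x → |t| ≤ C ∧ |f x t| ≤ M)
    {z : EuclideanSpace ℝ (Fin N)} (hz : z ∈ frontier Ω) {ε : ℝ} (hε : 0 < ε) :
    ∃ K : ℝ, ∀ x ∈ closure Ω, -barrier (-b z + ε) K z x ≤ perronSup Ω f b lo up x := by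
  obtain ⟨K₁, hK₁, h₁⟩ := exists_infinityLaplacian_barrier_lt (N := N) M (diam (closure Ω))
  obtain ⟨K₂, hK₂, h₂⟩ := exists_le_barrier_of_continuousOn
    (hbdd.isCompact_closure.of_isClosed_subset isClosed_frontier frontier_subset_closure)
    hb.neg hz hε
  have hlo_mem := lower_mem_perronFamily hΩ hlo hup hle
  have hzΩ : ∀ x ∈ Ω, x ≠ z := by
    rintro x hx rfl
    rw [hΩ.frontier_eq] at hz
    exact hz.2 hx
  set K := max K₁ K₂
  have hlap : ∀ y ∈ Ω, infinityLaplacian (barrier (-b z + ε) K z) y < -M := fun y hy => by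
    refine h₁ _ (le_max_left _ _) _ z y (hzΩ y hy) ?_
    rw [← dist_eq_norm]
    exact dist_le_diam_of_mem hbdd.isCompact_closure.isBounded (subset_closure hy)
      (frontier_subset_closure hz)
  have hbar : ∀ y ∈ frontier Ω, -b y ≤ barrier (-b z + ε) K z y := h₂ _ (le_max_right _ _)
  have hfr : ∀ y ∈ closure Ω, y ∉ Ω → y ∈ frontier Ω := fun y hy hyΩ => by
    rw [hΩ.frontier_eq]; exact ⟨hy, hyΩ⟩
  -- The reflected cusp stays below `up`; without this its maximum with `lo` would not belong to the
  -- family.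
  have hupbar : ∀ x ∈ closure Ω, -up x ≤ barrier (-b z + ε) K z x := by
    refine hup.isSupersolution.neg.le_of_infinityLaplacian_lt hbdd.isCompact_closure
      hup.continuousOn_closure.neg (continuous_barrier _ _ _).continuousOn hΩ subset_closure
      Subset.rfl (fun y hy => contDiffAt_barrier _ _ (hzΩ y hy)) (fun y hy => ?_)
      (fun y hy hyΩ => ?_)
    · have := (abs_le.1 (hCM y hy _ (hle y hy) le_rfl).2).2
      simp only [neg_neg]
      linarith [hlap y hy]
    · have hyf := hfr y hy hyΩ
      linarith [hup.boundary_le y hyf, hbar y hyf]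
  have hcont : Continuous fun x => -barrier (-b z + ε) K z x := (continuous_barrier _ _ _).neg
  have hv : (fun x => max (lo x) (-barrier (-b z + ε) K z x)) ∈ perronFamily Ω f b lo up := by
    have hvle : ∀ x ∈ closure Ω, max (lo x) (-barrier (-b z + ε) K z x) ≤ up x := fun x hx =>
      max_le (hlo_mem.2 x hx).2 (by linarith [hupbar x hx])
    have hvc : ContinuousOn (fun x => max (lo x) (-barrier (-b z + ε) K z x)) (closure Ω) :=
      hlo.continuousOn_closure.sup hcont.continuousOn
    refine ⟨⟨hvc, ?_, fun x hx => ?_⟩, fun x hx => ⟨le_max_left _ _, hvle x hx⟩⟩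
    · refine hlo.isSubsolution.of_touching hΩ (hvc.mono subset_closure)
        (fun x _ => le_max_left _ _) fun x hx hlt => ?_
      refine ⟨fun x => -barrier (-b z + ε) K z x, (contDiffAt_barrier _ _ (hzΩ x hx)).neg,
        ?_, Eventually.of_forall fun y => le_max_right _ _, ?_⟩
      · rcases lt_max_iff.1 hlt with h | h
        · exact absurd h (lt_irrefl _)
        · exact (max_eq_right h.le).symm
      · rw [infinityLaplacian_neg]
        have := (abs_le.1 (hCM x hx _ (le_max_left _ _) (hvle x (subset_closure hx))).2).2
        linarith [hlap x hx]
    · exact max_le (hlo.le_boundary x hx) (by linarith [hbar x hx])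
  exact ⟨K, fun x hx => (le_max_right _ _).trans (le_perronSup hv hx)⟩

theorem perronSup_eq_boundary (hΩ : IsOpen Ω) (hbdd : Bornology.IsBounded Ω) {C M : ℝ}
    (hb : ContinuousOn b (frontier Ω)) (hlo : IsDirichletSubsolution Ω f b lo)
    (hup : IsDirichletSupersolution Ω f b up) (hle : ∀ x ∈ Ω, lo x ≤ up x)
    (hCM : ∀ x ∈ Ω, ∀ t, lo x ≤ t → t ≤ up x → |t| ≤ C ∧ |f x t| ≤ M)
    {z : EuclideanSpace ℝ (Fin N)} (hz : z ∈ frontier Ω) :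
    perronSup Ω f b lo up z = b z := by
  apply le_antisymm
  · exact perronSup_le ⟨lo, lower_mem_perronFamily hΩ hlo hup hle⟩
      fun w hw => hw.1.le_boundary z hz
  · refine le_of_forall_pos_le_add fun ε hε => ?_
    obtain ⟨K, hK⟩ := neg_barrier_le_perronSup hΩ hbdd hb hlo hup hle hCM hz hε
    have := hK z (frontier_subset_closure hz)
    rw [barrier_self] at this
    linarith

/-- The Perron supremum is continuous up to the boundary. -/
theorem continuousOn_perronSup (hΩ : IsOpen Ω) (hbdd : Bornology.IsBounded Ω) {C M : ℝ}
    (hb : ContinuousOn b (frontier Ω)) (hlo : IsDirichletSubsolution Ω f b lo)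
    (hup : IsDirichletSupersolution Ω f b up) (hle : ∀ x ∈ Ω, lo x ≤ up x)
    (hCM : ∀ x ∈ Ω, ∀ t, lo x ≤ t → t ≤ up x → |t| ≤ C ∧ |f x t| ≤ M) :
    ContinuousOn (perronSup Ω f b lo up) (closure Ω) := by
  have hne : (perronFamily Ω f b lo up).Nonempty := ⟨lo, lower_mem_perronFamily hΩ hlo hup hle⟩
  intro z hz
  by_cases hzΩ : z ∈ Ω
  · exact (continuousAt_perronSup hΩ hne hCM hzΩ).continuousWithinAt
  have hzf : z ∈ frontier Ω := by rw [hΩ.frontier_eq]; exact ⟨hz, hzΩ⟩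
  rw [ContinuousWithinAt, perronSup_eq_boundary hΩ hbdd hb hlo hup hle hCM hzf]
  refine tendsto_order.2 ⟨fun a ha => ?_, fun a ha => ?_⟩
  · obtain ⟨K, hK⟩ := neg_barrier_le_perronSup hΩ hbdd hb hlo hup hle hCM hzf
      (half_pos (sub_pos.2 ha))
    have hlim := ((continuous_barrier (-b z + (b z - a) / 2) K z).neg.tendsto z).mono_left
      (nhdsWithin_le_nhds (s := closure Ω))
    rw [Pi.neg_apply, barrier_self] at hlim
    have h := hlim.eventually_const_lt (show a < _ by linarith)
    filter_upwards [h, self_mem_nhdsWithin] with x hx hxc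
    exact hx.trans_le (hK x hxc)
  · obtain ⟨K, hK⟩ := perronSup_le_barrier hΩ hbdd hb hne hCM hzf (half_pos (sub_pos.2 ha))
    have hlim := ((continuous_barrier (b z + (a - b z) / 2) K z).tendsto z).mono_left
      (nhdsWithin_le_nhds (s := closure Ω))
    rw [barrier_self] at hlim
    have h := hlim.eventually_lt_const (show _ < a by linarith)
    filter_upwards [h, self_mem_nhdsWithin] with x hx hxc
    exact (hK x hxc).trans_lt hx

/-! ### The supremum solves the equation -/

theorem isSubsolution_perronSup (hΩ : IsOpen Ω)
    (hf : ContinuousOn (fun p : EuclideanSpace ℝ (Fin N) × ℝ => f p.1 p.2) (Ω ×ˢ univ))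
    (hne : (perronFamily Ω f b lo up).Nonempty)
    (hc : ContinuousOn (perronSup Ω f b lo up) Ω) :
    IsSubsolution Ω f (perronSup Ω f b lo up) where
  continuousOn := hc
  le_infinityLaplacian ψ hψ x₀ hx₀ hmax := by
    by_contra! hlt
    set u := perronSup Ω f b lo up
    have hψ₀ : ContDiffAt ℝ 2 ψ x₀ := hψ.contDiffAt (hΩ.mem_nhds hx₀)
    -- The quartic makes the maximum strict with an explicit margin, leaving the infinity Laplacian
    -- at `x₀` unchanged.
    set ψ₁ : EuclideanSpace ℝ (Fin N) → ℝ := fun y => ψ y + 1 * ‖y - x₀‖ ^ 4 with hψ₁_def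
    have hψ₁ : ∀ x ∈ Ω, ContDiffAt ℝ 2 ψ₁ x := fun x hx =>
      (hψ.contDiffAt (hΩ.mem_nhds hx)).add
        (contDiff_const.mul (contDiff_norm_sub_pow_four x₀)).contDiffAt
    have hlt₁ : infinityLaplacian ψ₁ x₀ < f x₀ (u x₀) := by
      rwa [infinityLaplacian_add_quartic hψ₀]
    have hev : ∀ᶠ p : EuclideanSpace ℝ (Fin N) × ℝ in 𝓝 (x₀, u x₀),
        p.1 ∈ Ω ∧ infinityLaplacian ψ₁ p.1 < f p.1 p.2 := by
      have h1 : ContinuousAt (fun p : EuclideanSpace ℝ (Fin N) × ℝ => f p.1 p.2) (x₀, u x₀) :=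
        hf.continuousAt (prod_mem_nhds (hΩ.mem_nhds hx₀) univ_mem)
      have h2 : ContinuousAt (fun p : EuclideanSpace ℝ (Fin N) × ℝ => infinityLaplacian ψ₁ p.1)
          (x₀, u x₀) :=
        ContinuousAt.comp (f := Prod.fst) (continuousAt_infinityLaplacian (hψ₁ x₀ hx₀))
          continuousAt_fst
      exact (continuousAt_fst.eventually (hΩ.mem_nhds hx₀)).and (h2.eventually_lt h1 hlt₁)
    obtain ⟨η, hη, hball⟩ := Metric.eventually_nhds_iff.1 hev
    have hu₀ : ∀ᶠ x in 𝓝 x₀, u x < u x₀ + η :=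
      (hc.continuousAt (hΩ.mem_nhds hx₀)).eventually (gt_mem_nhds (by linarith))
    have hψ₁₀ : ∀ᶠ x in 𝓝 x₀, ψ₁ x₀ - η / 2 < ψ₁ x :=
      (hψ₁ x₀ hx₀).continuousAt.eventually (lt_mem_nhds (by linarith))
    obtain ⟨r, hr, hrball⟩ := Metric.nhds_basis_closedBall.mem_iff.1
      (((hu₀.and hψ₁₀).and hmax).and (ball_mem_nhds x₀ hη))
    have hrΩ : closedBall x₀ r ⊆ Ω := fun x hx =>
      (hball (y := (x, u x₀)) (by simpa [Prod.dist_eq] using (hrball hx).2)).1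
    -- The gap `r ^ 4` keeps the maximiser `y` of `w - ψ₁` off the sphere, while `η / 2` keeps `w y`
    -- within `η` of `u x₀`, where the strict inequality persists.
    obtain ⟨w, hw, hwx₀⟩ := exists_lt_of_lt_perronSup hne
      (show u x₀ - min (η / 2) (r ^ 4) < perronSup Ω f b lo up x₀ from
        sub_lt_self _ (by positivity))
    have hw₁ : u x₀ - η / 2 < w x₀ := by linarith [min_le_left (η / 2) (r ^ 4)]
    have hw₂ : u x₀ - r ^ 4 < w x₀ := by linarith [min_le_right (η / 2) (r ^ 4)]
    obtain ⟨y, hy, hymax⟩ := (isCompact_closedBall x₀ r).exists_isMaxOn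
      ⟨x₀, mem_closedBall_self hr.le⟩ (f := fun x => w x - ψ₁ x)
      ((hw.1.isSubsolution.continuousOn.mono hrΩ).sub
        fun x hx => (hψ₁ x (hrΩ hx)).continuousAt.continuousWithinAt)
    have h1 : w x₀ - ψ₁ x₀ ≤ w y - ψ₁ y := hymax (mem_closedBall_self hr.le)
    have h2 : w y ≤ u y := le_perronSup hw (subset_closure (hrΩ hy))
    obtain ⟨⟨⟨h3, h4⟩, h5⟩, h6⟩ := hrball hy
    have h3 : u y < u x₀ + η := h3
    have h4 : ψ₁ x₀ - η / 2 < ψ₁ y := h4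
    have h5 : u y - ψ y ≤ u x₀ - ψ x₀ := h5
    have e1 : ψ₁ x₀ = ψ x₀ := by simp [hψ₁_def]
    have e2 : ψ₁ y = ψ y + ‖y - x₀‖ ^ 4 := by simp [hψ₁_def]
    have hyr : ‖y - x₀‖ < r := lt_of_pow_lt_pow_left₀ 4 hr.le (by linarith)
    have hyball : y ∈ ball x₀ r := by rwa [mem_ball, dist_eq_norm]
    have hloc : IsLocalMax (fun x => w x - ψ₁ x) y :=
      hymax.isLocalMax (mem_of_superset (isOpen_ball.mem_nhds hyball) ball_subset_closedBall)
    have hle := hw.1.isSubsolution.le_of_contDiffAt (hrΩ hy) (hψ₁ y (hrΩ hy)) hloc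
    have hgt := (hball (y := (y, w y)) (by
      rw [Prod.dist_eq]
      refine max_lt h6 ?_
      rw [Real.dist_eq, abs_lt]
      constructor <;> linarith)).2
    exact absurd hgt (not_lt.2 hle)

/-- Were the test inequality to fail where `u < up`, raising `u` locally to a shifted test function
would give a member of the family exceeding its supremum. -/
theorem isSupersolution_perronSup (hΩ : IsOpen Ω)
    (hf : ContinuousOn (fun p : EuclideanSpace ℝ (Fin N) × ℝ => f p.1 p.2) (Ω ×ˢ univ))
    (hup : IsDirichletSupersolution Ω f b up)
    (hmem : perronSup Ω f b lo up ∈ perronFamily Ω f b lo up) :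
    IsSupersolution Ω f (perronSup Ω f b lo up) where
  continuousOn := hmem.1.isSubsolution.continuousOn
  infinityLaplacian_le ψ hψ x₀ hx₀ hmin := by
    by_contra! hlt
    set u := perronSup Ω f b lo up with hu_def
    have hule : ∀ x ∈ Ω, u x ≤ up x := fun x hx => (hmem.2 x (subset_closure hx)).2
    -- Where `u` meets `up` there is no room for a bump, but `ψ` then touches `up` itself from
    -- below.
    rcases (hule x₀ hx₀).eq_or_lt with heq | hstrict
    · refine absurd (hup.isSupersolution.infinityLaplacian_le ψ hψ x₀ hx₀ ?_)
        (not_le.2 (heq ▸ hlt))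
      filter_upwards [hmin, hΩ.mem_nhds hx₀] with x hx hxΩ
      linarith [hule x hxΩ]
    have hψ₀ : ContDiffAt ℝ 2 ψ x₀ := hψ.contDiffAt (hΩ.mem_nhds hx₀)
    set φ : EuclideanSpace ℝ (Fin N) → ℝ :=
      fun y => (ψ y + (-1) * ‖y - x₀‖ ^ 4) + (u x₀ - ψ x₀) with hφ_def
    have hφ : ∀ x ∈ Ω, ContDiffAt ℝ 2 φ x := fun x hx =>
      ((hψ.contDiffAt (hΩ.mem_nhds hx)).add
        (contDiff_const.mul (contDiff_norm_sub_pow_four x₀)).contDiffAt).add contDiffAt_const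
    have hφ₀ : φ x₀ = u x₀ := by simp [hφ_def]
    have hlt₁ : f x₀ (φ x₀ + 0) < infinityLaplacian φ x₀ := by
      rwa [hφ₀, add_zero, hφ_def, infinityLaplacian_add_const, infinityLaplacian_add_quartic hψ₀]
    -- The second coordinate is the height of the bump; the product neighbourhood controls position
    -- and height together.
    have hev : ∀ᶠ p : EuclideanSpace ℝ (Fin N) × ℝ in 𝓝 (x₀, 0),
        (p.1 ∈ Ω ∧ u x₀ - ψ x₀ ≤ u p.1 - ψ p.1) ∧
          f p.1 (φ p.1 + p.2) < infinityLaplacian φ p.1 ∧ φ p.1 + p.2 < up p.1 := by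
      have h0 : ContinuousAt (fun p : EuclideanSpace ℝ (Fin N) × ℝ => φ p.1 + p.2) (x₀, 0) :=
        ContinuousAt.add (f := fun p : EuclideanSpace ℝ (Fin N) × ℝ => φ p.1) (g := Prod.snd)
          (ContinuousAt.comp (f := Prod.fst) (g := φ) (x := (x₀, (0 : ℝ)))
            (hφ x₀ hx₀).continuousAt continuousAt_fst)
          continuousAt_snd
      have h1 : ContinuousAt (fun p : EuclideanSpace ℝ (Fin N) × ℝ => f p.1 (φ p.1 + p.2))
          (x₀, 0) :=
        ContinuousAt.comp (g := fun p : EuclideanSpace ℝ (Fin N) × ℝ => f p.1 p.2)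
          (f := fun p : EuclideanSpace ℝ (Fin N) × ℝ => (p.1, φ p.1 + p.2))
          (hf.continuousAt (prod_mem_nhds (hΩ.mem_nhds hx₀) univ_mem))
          (continuousAt_fst.prodMk h0)
      have h2 : ContinuousAt (fun p : EuclideanSpace ℝ (Fin N) × ℝ => infinityLaplacian φ p.1)
          (x₀, 0) :=
        ContinuousAt.comp (f := Prod.fst) (continuousAt_infinityLaplacian (hφ x₀ hx₀))
          continuousAt_fst
      have h3 : ContinuousAt (fun p : EuclideanSpace ℝ (Fin N) × ℝ => up p.1) (x₀, 0) :=
        ContinuousAt.comp (f := Prod.fst)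
          (hup.isSupersolution.continuousOn.continuousAt (hΩ.mem_nhds hx₀)) continuousAt_fst
      have h4 : ∀ᶠ x in 𝓝 x₀, x ∈ Ω ∧ u x₀ - ψ x₀ ≤ u x - ψ x :=
        Filter.Eventually.and (hΩ.mem_nhds hx₀) hmin
      exact (continuousAt_fst.eventually h4).and ((h1.eventually_lt h2 hlt₁).and (h0.eventually_lt h3 (by simpa [hφ₀])))
    obtain ⟨ε, hε, hball⟩ := Metric.eventually_nhds_iff.1 hev
    -- `c < ε` keeps the raised function admissible. Since `φ ≤ u - ‖x - x₀‖⁴` on the ball, `c < (ε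
    -- / 2) ^ 4` puts `φ + c` below `u` beyond radius `ε / 2`, so the gluing is continuous.
    obtain ⟨c, hc, hcε, hc4⟩ : ∃ c : ℝ, 0 < c ∧ c < ε ∧ c < (ε / 2) ^ 4 := by
      obtain ⟨c, hc, hc'⟩ := exists_between (show (0 : ℝ) < min ε ((ε / 2) ^ 4) by positivity)
      exact ⟨c, hc, lt_min_iff.1 hc'⟩
    have hin : ∀ x ∈ ball x₀ ε, (x ∈ Ω ∧ u x₀ - ψ x₀ ≤ u x - ψ x) ∧
        f x (φ x + c) < infinityLaplacian φ x ∧ φ x + c < up x := fun x hx =>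
      hball (y := (x, c)) (by
        rw [Prod.dist_eq]
        exact max_lt hx (by simpa [abs_of_pos hc] using hcε))
    classical
    set v : EuclideanSpace ℝ (Fin N) → ℝ :=
      fun x => if x ∈ ball x₀ ε then max (u x) (φ x + c) else u x with hv_def
    have hv_in : ∀ x ∈ ball x₀ ε, v x = max (u x) (φ x + c) := fun x hx => if_pos hx
    have hv_out : ∀ x, ε / 2 < dist x x₀ → v x = u x := fun x hx => by
      by_cases hxb : x ∈ ball x₀ ε
      · rw [hv_in x hxb]
        refine max_eq_left ?_
        have h1 := (hin x hxb).1.2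
        have h2 : (ε / 2) ^ 4 ≤ ‖x - x₀‖ ^ 4 := by
          rw [← dist_eq_norm]; gcongr
        simp only [hφ_def]
        linarith
      · exact if_neg hxb
    have huv : ∀ x, u x ≤ v x := fun x => by
      by_cases hxb : x ∈ ball x₀ ε
      · rw [hv_in x hxb]; exact le_max_left _ _
      · exact (if_neg hxb).ge
    have hvc : ContinuousOn v (closure Ω) := fun x hx => by
      have hux := hmem.1.continuousOn_closure x hx
      by_cases hxb : x ∈ ball x₀ ε
      · have h1 : ContinuousWithinAt (fun y => max (u y) (φ y + c)) (closure Ω) x :=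
          hux.sup ((hφ x (hin x hxb).1.1).continuousAt.continuousWithinAt.add
            continuousWithinAt_const)
        refine h1.congr_of_eventuallyEq ?_ (hv_in x hxb)
        exact mem_nhdsWithin_of_mem_nhds (mem_of_superset (isOpen_ball.mem_nhds hxb) hv_in)
      · have hd : ε / 2 < dist x x₀ := by
          have : ε ≤ dist x x₀ := not_lt.1 fun h => hxb h
          linarith
        refine hux.congr_of_eventuallyEq ?_ (hv_out x hd)
        exact mem_nhdsWithin_of_mem_nhds (mem_of_superset
          ((isOpen_lt continuous_const (continuous_id.dist continuous_const)).mem_nhds hd) hv_out)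
    have hvmem : v ∈ perronFamily Ω f b lo up := by
      refine ⟨⟨hvc, ?_, fun x hx => ?_⟩, fun x hx => ⟨(hmem.2 x hx).1.trans (huv x), ?_⟩⟩
      · refine hmem.1.isSubsolution.of_touching hΩ (hvc.mono subset_closure)
          (fun x _ => huv x) fun x hx hlt' => ?_
        have hxb : x ∈ ball x₀ ε := by
          by_contra hxb
          exact hlt'.ne (if_neg hxb).symm
        have hvx : v x = φ x + c := by
          rw [hv_in x hxb] at hlt' ⊢
          rcases lt_max_iff.1 hlt' with h | h
          · exact absurd h (lt_irrefl _)
          · exact max_eq_right h.le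
        refine ⟨fun y => φ y + c, (hφ x hx).add contDiffAt_const, hvx.symm, ?_, ?_⟩
        · filter_upwards [isOpen_ball.mem_nhds hxb] with y hy
          rw [hv_in y hy]; exact le_max_right _ _
        · rw [infinityLaplacian_add_const, hvx]
          exact (hin x hxb).2.1.le
      · have hxb : x ∉ ball x₀ ε := fun hxb => by
          rw [hΩ.frontier_eq] at hx
          exact hx.2 (hin x hxb).1.1
        rw [show v x = u x from if_neg hxb]
        exact hmem.1.le_boundary x hx
      · by_cases hxb : x ∈ ball x₀ ε
        · rw [hv_in x hxb]
          exact max_le (hmem.2 x hx).2 (hin x hxb).2.2.le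
        · rw [show v x = u x from if_neg hxb]
          exact (hmem.2 x hx).2
    have h1 : v x₀ ≤ u x₀ := le_perronSup hvmem (subset_closure hx₀)
    rw [hv_in x₀ (mem_ball_self hε), hφ₀] at h1
    linarith [le_max_right (u x₀) (u x₀ + c)]

end Perron

end InfinityLaplace

theorem theorem3p1 {N : ℕ} (hN : 2 ≤ N)
    (Ω : Set (EuclideanSpace ℝ (Fin N)))
    (hΩ_open : IsOpen Ω) (hΩ_conn : IsConnected Ω) (hΩ_bdd : Bornology.IsBounded Ω)
    (f : EuclideanSpace ℝ (Fin N) → ℝ → ℝ)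
    (hf_cont : ContinuousOn (fun p : EuclideanSpace ℝ (Fin N) × ℝ => f p.1 p.2)
      (Ω ×ˢ (Set.univ : Set ℝ)))
    (hf_bdd : ∀ c d : ℝ, ∃ M : ℝ, ∀ x ∈ Ω, ∀ t ∈ Set.Icc c d, |f x t| ≤ M)
    (b : EuclideanSpace ℝ (Fin N) → ℝ) (hb : ContinuousOn b (frontier Ω))
    (uLower uUpper : EuclideanSpace ℝ (Fin N) → ℝ)
    (hLower : InfinityLaplace.IsDirichletSubsolution Ω f b uLower)
    (hUpper : InfinityLaplace.IsDirichletSupersolution Ω f b uUpper)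
    (hle : ∀ x ∈ Ω, uLower x ≤ uUpper x) :
    ∃ u : EuclideanSpace ℝ (Fin N) → ℝ,
      InfinityLaplace.IsDirichletSolution Ω f b u ∧
        ∀ x ∈ Ω, uLower x ≤ u x ∧ u x ≤ uUpper x := by

  obtain ⟨C, M, hCM⟩ := InfinityLaplace.exists_bounds hΩ_bdd hf_bdd hLower hUpper
  have hne : (InfinityLaplace.perronFamily Ω f b uLower uUpper).Nonempty :=
    ⟨uLower, InfinityLaplace.lower_mem_perronFamily hΩ_open hLower hUpper hle⟩
  have hc := InfinityLaplace.continuousOn_perronSup hΩ_open hΩ_bdd hb hLower hUpper hle hCM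
  have hbd : ∀ z ∈ frontier Ω, InfinityLaplace.perronSup Ω f b uLower uUpper z = b z :=
    fun z hz => InfinityLaplace.perronSup_eq_boundary hΩ_open hΩ_bdd hb hLower hUpper hle hCM hz
  have hsub := InfinityLaplace.isSubsolution_perronSup hΩ_open hf_cont hne (hc.mono subset_closure)
  -- The supremum is attained as a member of the family, which the bump argument requires.
  have hmem : InfinityLaplace.perronSup Ω f b uLower uUpper ∈
      InfinityLaplace.perronFamily Ω f b uLower uUpper :=
    ⟨⟨hc, hsub, fun z hz => (hbd z hz).le⟩, fun x hx =>
      ⟨InfinityLaplace.le_perronSup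
        (InfinityLaplace.lower_mem_perronFamily hΩ_open hLower hUpper hle) hx,
        InfinityLaplace.perronSup_le hne fun w hw => (hw.2 x hx).2⟩⟩
  exact ⟨InfinityLaplace.perronSup Ω f b uLower uUpper,
    ⟨hc, ⟨hsub, InfinityLaplace.isSupersolution_perronSup hΩ_open hf_cont hUpper hmem⟩, hbd⟩,
    fun x hx => hmem.2 x (subset_closure hx)⟩
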